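/- Let $K$ be an algebraically closed field of characteristic zero, let $d\ge 1$, let $S_d$ be the space of homogeneous polynomials of degree $d$ in two variables over $K$, and let $S_d^*$ be its dual. For $\alpha\in K^2$ let $ev(\alpha)\in S_d^*$ be evaluation at $\alpha$, and let the rank $\operatorname{rk}\varphi$ of $\varphi\in S_d^*$ be the least integer $r$ such that $\varphi=ev(\alpha_1)+\dots+ev(\alpha_r)$ for some $\alpha_1,\dots,\alpha_r\in K^2$. Let $X\subset\mathbb P(S_d^*)$ be the Veronese curve, that is, the image of $\mathbb P^1(K)\to\mathbb P(S_d^*)$, $[\alpha]\mapsto[ev(\alpha)]$, and let $\sigma^k(X)$ be the Zariski closure of the union of all $k$-planes spanned by $k+1$ points of $X$. Let $0\le k\le\left[\frac{d-1}{2}\right]$ and let $\varphi\in S_d^*$ be nonzero. If $[\varphi]\in\sigma^k(X)$ does not lie on any $k$-plane spanned by $k+1$ points of $X$, then $\operatorname{rk}\varphi\ge d-k+1$. -/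

import Mathlib

open scoped LinearAlgebra.Projectivization

noncomputable section

namespace BinaryForms

/-- The space `S_d` of homogeneous polynomials of degree `d` in two variables over `K`. -/
abbrev Form (K : Type*) [Field K] (d : ℕ) : Type _ :=
  MvPolynomial.homogeneousSubmodule (Fin 2) K d

/-- The dual space `S_d^*`. -/
abbrev Functional (K : Type*) [Field K] (d : ℕ) : Type _ :=
  Module.Dual K (Form K d)

variable {K : Type*} [Field K]

/-- The functional `ev(α) ∈ S_d^*`, evaluation of forms of degree `d` at `α ∈ K^2`. -/
def ev (d : ℕ) (α : Fin 2 → K) : Functional K d :=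
  (MvPolynomial.aeval α).toLinearMap ∘ₗ (MvPolynomial.homogeneousSubmodule (Fin 2) K d).subtype

theorem ev_apply (d : ℕ) (α : Fin 2 → K) (f : Form K d) :
    ev d α f = MvPolynomial.eval α (f : MvPolynomial (Fin 2) K) := by
  simp [ev, MvPolynomial.aeval_eq_eval]

theorem ev_ne_zero (d : ℕ) {α : Fin 2 → K} (hα : α ≠ 0) : ev d α ≠ 0 := by
  obtain ⟨i, hi⟩ := Function.ne_iff.mp hα
  intro h
  have h1 := congrArg
    (fun φ : Functional K d => φ ⟨MvPolynomial.X i ^ d, MvPolynomial.isHomogeneous_X_pow i d⟩) h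
  simp only [ev_apply, map_pow, MvPolynomial.eval_X, LinearMap.zero_apply] at h1
  exact pow_ne_zero d hi h1

/-- The monomial `x^{d-i} y^i`, for `0 ≤ i ≤ d`, as an element of `S_d`. -/
def monom (K : Type*) [Field K] (d : ℕ) (i : Fin (d + 1)) : Form K d :=
  ⟨MvPolynomial.X 0 ^ (d - (i : ℕ)) * MvPolynomial.X 1 ^ (i : ℕ), by
    have h := (MvPolynomial.isHomogeneous_X_pow (R := K) (0 : Fin 2) (d - (i : ℕ))).mul
      (MvPolynomial.isHomogeneous_X_pow (1 : Fin 2) (i : ℕ))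
    rwa [Nat.sub_add_cancel (Nat.le_of_lt_succ i.isLt)] at h⟩

/-- The coordinates `Z_i = φ(x^{d-i} y^i)` of `φ ∈ S_d^*`. -/
def coords (d : ℕ) (φ : Functional K d) : Fin (d + 1) → K :=
  fun i => φ (monom K d i)

/-- The rank of `φ`: the least `r` such that `φ = ev(α_1) + ... + ev(α_r)` for some `α_i ∈ K^2`. -/
def rank (d : ℕ) (φ : Functional K d) : ℕ :=
  sInf {r : ℕ | ∃ α : Fin r → (Fin 2 → K), φ = ∑ i, ev d (α i)}

/-- The Veronese curve `X ⊆ ℙ(S_d^*)`, the image of `[α] ↦ [ev(α)]`. -/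
def veronese (K : Type*) [Field K] (d : ℕ) : Set (ℙ K (Functional K d)) :=
  {P | ∃ (α : Fin 2 → K) (hα : α ≠ 0), P = Projectivization.mk K (ev d α) (ev_ne_zero d hα)}

/-- `P` lies on a `k`-plane spanned by `k + 1` points of the Veronese curve. (That the `k + 1`
points span a linear space of dimension exactly `k` is their independence.) -/
def OnSecantPlane (d k : ℕ) (P : ℙ K (Functional K d)) : Prop :=
  ∃ p : Fin (k + 1) → ℙ K (Functional K d),
    (∀ i, p i ∈ veronese K d) ∧ Projectivization.Independent p ∧
      P ∈ Projectivization.Subspace.span (Set.range p)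

/-- Zariski closure in `ℙ(S_d^*)`: the common zeros of all homogeneous polynomials in the
homogeneous coordinates `Z_0, ..., Z_d` that vanish on `T`. -/
def zariskiClosure (d : ℕ) (T : Set (ℙ K (Functional K d))) : Set (ℙ K (Functional K d)) :=
  {P | ∀ (m : ℕ) (F : MvPolynomial (Fin (d + 1)) K), F.IsHomogeneous m →
    (∀ Q ∈ T, MvPolynomial.eval (coords d Q.rep) F = 0) →
      MvPolynomial.eval (coords d P.rep) F = 0}

/-- The secant variety `σ^k(X)`: the Zariski closure of the union of the `k`-planes spanned by
`k + 1` points of the Veronese curve `X`. -/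
def secantVariety (K : Type*) [Field K] (d k : ℕ) : Set (ℙ K (Functional K d)) :=
  zariskiClosure d {P | OnSecantPlane d k P}

end BinaryForms

end

open scoped LinearAlgebra.Projectivization
open Matrix

/-! Put `n = d - k - 1` and pair `S_{k+1} × S_n → K` by `(g, h) ↦ φ(g h)`. On a secant `k`-plane
some `g ≠ 0` vanishes at the `k + 1` points, so the maximal minors of this catalecticant vanish;
this persists on the closure (`exists_vecMul_catalecticant_eq_zero`). If `rk φ ≤ d - k = n + 1`,
then `φ = ∑ c_i ev(p_i)` with `n + 1` distinct points, whose evaluations on `S_n` are independent.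
Hence `c_i g(p_i) = 0` for all `i`. As `g` has at most `k + 1` roots, `φ` lies on a secant `k`-plane
(`onSecantPlane_of_rank_le`). -/

namespace BinaryForms

/-! ### Linear and projective algebra -/

section General

/-- A matrix over a field all of whose maximal minors vanish has linearly dependent rows. -/
theorem exists_vecMul_eq_zero_of_minors {F : Type*} [Field F] {m n : ℕ}
    (A : Matrix (Fin m) (Fin n) F)
    (h : ∀ e : Fin m → Fin n, (A.submatrix id e).det = 0) : ∃ v ≠ 0, v ᵥ* A = 0 := by
  by_contra! hA
  have hrows : LinearIndependent F A.row := by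
    rw [← vecMul_injective_iff]
    refine (injective_iff_map_eq_zero A.vecMulLinear).mpr fun v hv => ?_
    by_contra hv0
    exact hA v hv0 hv
  obtain ⟨κ, a, ha, hspan, hli⟩ := exists_linearIndependent' F A.col
  have : Finite κ := Finite.of_injective a ha
  have := Fintype.ofFinite κ
  have hcard : Fintype.card κ = m := by
    rw [← finrank_span_eq_card hli, hspan, ← rank_eq_finrank_span_cols, hrows.rank_matrix,
      Fintype.card_fin]
  let e : Fin m ≃ κ := (Fintype.equivFinOfCardEq hcard).symm
  have hcols : LinearIndependent F (A.submatrix id (a ∘ e)).col := hli.comp e e.injective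
  have hunit := linearIndependent_cols_iff_isUnit.mp hcols
  exact ((isUnit_iff_isUnit_det _).mp hunit).ne_zero (h _)

theorem mk_mem_span_range_iff {F V ι : Type*} [Field F] [AddCommGroup V] [Module F V]
    (w : ι → V) (hw : ∀ i, w i ≠ 0) {x : V} (hx : x ≠ 0) :
    Projectivization.mk F x hx ∈
        Projectivization.Subspace.span (Set.range fun i => Projectivization.mk F (w i) (hw i)) ↔
      x ∈ Submodule.span F (Set.range w) := by
  constructor
  · intro h
    rw [← Submodule.mk_mem_projectivization_iff _ hx]
    refine (Projectivization.Subspace.mem_span _).mp h _ ?_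
    rintro _ ⟨i, rfl⟩
    exact (Submodule.mk_mem_projectivization_iff _ (hw i)).mpr
      (Submodule.subset_span (Set.mem_range_self i))
  · intro h
    rw [← Projectivization.Subspace.mem_submodule_iff _ hx]
    refine Submodule.span_le.mpr ?_ h
    rintro _ ⟨i, rfl⟩
    exact (Projectivization.Subspace.mem_submodule_iff _ (hw i)).mpr
      (Projectivization.Subspace.subset_span _ (Set.mem_range_self i))

theorem isHomogeneous_det {σ R : Type*} [CommRing R] {n : ℕ}
    (M : Matrix (Fin n) (Fin n) (MvPolynomial σ R)) (h : ∀ i j, (M i j).IsHomogeneous 1) :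
    M.det.IsHomogeneous n := by
  rw [det_apply]
  refine MvPolynomial.IsHomogeneous.sum _ _ _ fun τ _ => ?_
  have hprod : (∏ i, M (τ i) i).IsHomogeneous n := by
    simpa using MvPolynomial.IsHomogeneous.prod Finset.univ (fun i => M (τ i) i) (fun _ => 1)
      fun i _ => h _ _
  -- The sign acts as an integer scalar.
  exact ((MvPolynomial.homogeneousSubmodule σ R n).restrictScalars ℤ).smul_mem
    ((Equiv.Perm.sign τ : ℤˣ) : ℤ) hprod

end General

/-! ### Catalecticant matrices -/

section Coordinates

variable {K : Type*} [Field K]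

/-- The coordinate map `φ ↦ (Z_0, ..., Z_d)` as a linear map. -/
noncomputable def coordsₗ (K : Type*) [Field K] (d : ℕ) : Functional K d →ₗ[K] (Fin (d + 1) → K) where
  toFun := coords d
  map_add' _ _ := rfl
  map_smul' _ _ := rfl

@[simp]
theorem coordsₗ_apply (d : ℕ) (φ : Functional K d) : coordsₗ K d φ = coords d φ := rfl

theorem coords_ev (d : ℕ) (α : Fin 2 → K) (i : Fin (d + 1)) :
    coords d (ev d α) i = α 0 ^ (d - (i : ℕ)) * α 1 ^ (i : ℕ) := by
  simp [coords, ev_apply, monom]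

theorem ev_smul (d : ℕ) (c : K) (α : Fin 2 → K) : ev d (c • α) = c ^ d • ev d α := by
  ext ⟨f, hf⟩
  have hf' : f.IsHomogeneous d := hf
  simp only [ev_apply, LinearMap.smul_apply, smul_eq_mul]
  rw [MvPolynomial.eval_eq', MvPolynomial.eval_eq', Finset.mul_sum]
  refine Finset.sum_congr rfl fun s hs => ?_
  have hdeg : s 0 + s 1 = d := by
    simpa [Finsupp.weight_apply, Finsupp.sum_fintype] using hf' (MvPolynomial.mem_support_iff.mp hs)
  simp only [Fin.prod_univ_two, Pi.smul_apply, smul_eq_mul, ← hdeg]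
  ring

/-- The matrix `(Z_{i+j})` of the pairing `S_m × S_n → K`, `(g, h) ↦ φ(g h)`. -/
def catalecticant {R : Type*} {d m n : ℕ} (h : m + n = d) (z : Fin (d + 1) → R) :
    Matrix (Fin (m + 1)) (Fin (n + 1)) R :=
  of fun i j => z ⟨i + j, by omega⟩

theorem catalecticant_ev {d m n : ℕ} (h : m + n = d) (α : Fin 2 → K) :
    catalecticant h (coords d (ev d α)) =
      vecMulVec (coords m (ev m α)) (coords n (ev n α)) := by
  ext i j
  simp only [catalecticant, of_apply, coords_ev, vecMulVec_apply]
  rw [show d - ((i : ℕ) + j) = (m - i) + (n - j) by omega, pow_add, pow_add]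
  ring

/-- Each evaluation contributes a rank-one matrix. Reading `v` as the coefficients of a form `g` of
degree `m`, the dot product is `g(α i)`. -/
theorem vecMul_catalecticant_sum_ev {d m n : ℕ} (h : m + n = d) {ι : Type*} [Fintype ι]
    (c : ι → K) (α : ι → Fin 2 → K) (v : Fin (m + 1) → K) :
    v ᵥ* catalecticant h (coords d (∑ i, c i • ev d (α i))) =
      ∑ i, (c i * v ⬝ᵥ coords m (ev m (α i))) • coords n (ev n (α i)) := by
  have hcat : catalecticant h (coords d (∑ i, c i • ev d (α i))) =
      ∑ i, c i • vecMulVec (coords m (ev m (α i))) (coords n (ev n (α i))) := by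
    simp only [← catalecticant_ev h]
    rw [← coordsₗ_apply, map_sum]
    ext a b
    simp [catalecticant, Matrix.sum_apply]
  rw [hcat, vecMul_sum]
  simp [vecMul_smul, vecMul_vecMulVec, smul_smul]

end Coordinates

/-! ### Evaluations at distinct points of the projective line -/

section Points

variable {K : Type*} [Field K]

theorem rep_mul_rep_ne {p q : ℙ K (Fin 2 → K)} (h : p ≠ q) :
    p.rep 1 * q.rep 0 - q.rep 1 * p.rep 0 ≠ 0 := by
  intro h0
  have hli := Projectivization.linearIndependent_pair_iff_ne.mpr h
  have hdet : IsUnit (Matrix.of ![p.rep, q.rep]).det :=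
    (isUnit_iff_isUnit_det _).mp (linearIndependent_rows_iff_isUnit.mp hli)
  rw [det_fin_two] at hdet
  apply hdet.ne_zero
  simp
  linear_combination -h0

/-- The evaluations at `n + 1` distinct points form a basis of `S_n^*`. -/
theorem det_coords_ev_ne_zero {n : ℕ} {p : Fin (n + 1) → ℙ K (Fin 2 → K)}
    (hp : Function.Injective p) :
    (of fun i => coords n (ev n (p i).rep)).det ≠ 0 := by
  have hV : (of fun i => coords n (ev n (p i).rep)) =
      projVandermonde (fun i => (p i).rep 1) (fun i => (p i).rep 0) := by
    ext i j
    rw [of_apply, coords_ev, projVandermonde_apply, mul_comm, Fin.val_rev]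
    congr 2
    omega
  rw [hV, det_projVandermonde]
  refine Finset.prod_ne_zero_iff.mpr fun i _ => Finset.prod_ne_zero_iff.mpr fun j hj => ?_
  exact rep_mul_rep_ne (hp.ne (Finset.mem_Ioi.mp hj).ne')

theorem infinite_projectiveLine [Infinite K] : Infinite (ℙ K (Fin 2 → K)) := by
  have hne : ∀ t : K, ![1, t] ≠ 0 := fun t h => one_ne_zero (congrFun h 0)
  refine Infinite.of_injective (fun t : K => Projectivization.mk K ![1, t] (hne t)) ?_
  intro s t hst
  obtain ⟨a, ha⟩ := (Projectivization.mk_eq_mk_iff' K _ _ (hne s) (hne t)).mp hst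
  have h0 := congrFun ha 0
  have h1 := congrFun ha 1
  simp at h0 h1
  simpa [h0] using h1.symm

/-- Finitely many points of the projective line can be completed to `n` distinct points. -/
theorem exists_injective_superset [Infinite K] (T : Finset (ℙ K (Fin 2 → K))) {n : ℕ}
    (hT : T.card ≤ n) :
    ∃ p : Fin n → ℙ K (Fin 2 → K), Function.Injective p ∧ (T : Set _) ⊆ Set.range p := by
  have := infinite_projectiveLine (K := K)
  obtain ⟨U, hTU, hU⟩ := Infinite.exists_superset_card_eq T n hT
  let e := (U.equivFinOfCardEq hU).symm
  refine ⟨fun i => e i, Subtype.val_injective.comp e.injective, fun x hx => ?_⟩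
  exact ⟨e.symm ⟨x, hTU hx⟩, by simp⟩

/-- Evaluations at no more than `d + 1` distinct points are linearly independent. -/
theorem linearIndependent_ev [Infinite K] {d m : ℕ} (hm : m ≤ d + 1)
    {p : Fin m → ℙ K (Fin 2 → K)} (hp : Function.Injective p) :
    LinearIndependent K fun i => ev d (p i).rep := by
  classical
  -- With `d + 1` points the coordinate matrix is a square Vandermonde matrix.
  obtain ⟨q, hq, hpq⟩ := exists_injective_superset (Finset.univ.image p) (n := d + 1)
    ((Finset.card_image_le).trans (by simpa using hm))
  have hq' : LinearIndependent K fun i => ev d (q i).rep := by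
    refine LinearIndependent.of_comp (coordsₗ K d) ?_
    exact linearIndependent_rows_iff_isUnit.mpr
      ((isUnit_iff_isUnit_det _).mpr (det_coords_ev_ne_zero hq).isUnit)
  choose s hs using fun i => hpq (show p i ∈ _ by simp)
  have hs' : Function.Injective s := fun i j hij => hp (by rw [← hs i, ← hs j, hij])
  simpa [Function.comp_def, hs] using hq'.comp s hs'

theorem ev_mem_span_rep (d : ℕ) {α : Fin 2 → K} (hα : α ≠ 0) :
    ev d α ∈ Submodule.span K {ev d (Projectivization.mk K α hα).rep} := by
  obtain ⟨a, ha⟩ := (Projectivization.mk_eq_mk_iff' K _ _ hα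
    (Projectivization.rep_nonzero _)).mp (Projectivization.mk_rep (Projectivization.mk K α hα)).symm
  refine Submodule.mem_span_singleton.mpr ⟨a ^ d, ?_⟩
  rw [← ev_smul, ha]

end Points

/-! ### Decompositions into evaluations -/

section Rank

variable {K : Type*} [Field K]

theorem ev_zero {d : ℕ} (hd : 1 ≤ d) : ev d (0 : Fin 2 → K) = 0 := by
  have := ev_smul d (0 : K) 0
  rwa [zero_smul, zero_pow (by omega), zero_smul] at this

/-- Over an infinite field a form vanishing at every point is zero; duality in finite dimension does
the rest. -/
theorem span_range_ev [Infinite K] (d : ℕ) : Submodule.span K (Set.range (ev (K := K) d)) = ⊤ := by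
  have : Module.Finite K (Form K d) :=
    Module.Finite.iff_fg.mpr (MvPolynomial.homogeneousSubmodule_fg (Fin 2) K d)
  have hbot : (Submodule.span K (Set.range (ev (K := K) d))).dualCoannihilator = ⊥ := by
    refine (Submodule.eq_bot_iff _).mpr fun (f : Form K d) hf => Subtype.ext ?_
    refine MvPolynomial.IsHomogeneous.eq_zero_of_forall_eval_eq_zero f.2 fun α => ?_
    rw [← ev_apply]
    exact (Submodule.mem_dualCoannihilator f).mp hf _ (Submodule.subset_span ⟨α, rfl⟩)
  rw [← Subspace.dualCoannihilator_dualAnnihilator_eq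
    (W := Submodule.span K (Set.range (ev (K := K) d))), hbot, Submodule.dualAnnihilator_bot]

/-- Over an algebraically closed field every functional is a sum of evaluations. -/
theorem exists_eq_sum_ev [IsAlgClosed K] {d : ℕ} (hd : 1 ≤ d) (φ : Functional K d) :
    ∃ (r : ℕ) (α : Fin r → Fin 2 → K), φ = ∑ i, ev d (α i) := by
  have hφ : φ ∈ Submodule.span K (Set.range (ev (K := K) d)) := by
    rw [span_range_ev]
    exact Submodule.mem_top
  obtain ⟨r, c, g, hg⟩ := (Submodule.mem_span_set').mp hφ
  choose β hβ using fun i => (g i).2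
  -- A `d`-th root absorbs each coefficient into its point.
  choose t ht using fun i => IsAlgClosed.exists_pow_nat_eq (c i) (n := d) (by omega)
  refine ⟨r, fun i => t i • β i, ?_⟩
  simp [ev_smul, ht, hβ, hg]

/-- Since `sInf ∅ = 0`, the minimum is attained only because some decomposition exists. -/
theorem exists_eq_sum_ev_rank [IsAlgClosed K] {d : ℕ} (hd : 1 ≤ d) (φ : Functional K d) :
    ∃ α : Fin (rank d φ) → Fin 2 → K, φ = ∑ i, ev d (α i) :=
  Nat.sInf_mem (s := {r : ℕ | ∃ α : Fin r → (Fin 2 → K), φ = ∑ i, ev d (α i)})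
    (exists_eq_sum_ev hd φ)

/-- A functional of rank at most `n` is a combination of evaluations at `n` distinct points. -/
theorem exists_distinct_points_of_rank_le [IsAlgClosed K] {d n : ℕ} (hd : 1 ≤ d)
    (φ : Functional K d) (hn : rank d φ ≤ n) :
    ∃ (p : Fin n → ℙ K (Fin 2 → K)) (c : Fin n → K), Function.Injective p ∧
      φ = ∑ i, c i • ev d (p i).rep := by
  classical
  obtain ⟨α, hα⟩ := exists_eq_sum_ev_rank hd φ
  let T : Finset (ℙ K (Fin 2 → K)) := Finset.univ.image
    fun i : {i // α i ≠ 0} => Projectivization.mk K (α i) i.2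
  have hT : T.card ≤ n :=
    Finset.card_image_le.trans ((Fintype.card_subtype_le _).trans (by simpa using hn))
  obtain ⟨p, hp, hTp⟩ := exists_injective_superset T hT
  have hφ : φ ∈ Submodule.span K (Set.range fun i => ev d (p i).rep) := by
    rw [hα]
    refine Submodule.sum_mem _ fun i _ => ?_
    by_cases hi : α i = 0
    · rw [hi, ev_zero hd]
      exact Submodule.zero_mem _
    · obtain ⟨j, hj⟩ := hTp (show Projectivization.mk K (α i) hi ∈ (T : Set _) from
        Finset.mem_coe.mpr (Finset.mem_image.mpr ⟨⟨i, hi⟩, by simp, rfl⟩))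
      refine Submodule.span_mono ?_ (ev_mem_span_rep d hi)
      rw [← hj]
      exact Set.singleton_subset_iff.mpr ⟨j, rfl⟩
  obtain ⟨c, hc⟩ := (Submodule.mem_span_range_iff_exists_fun K).mp hφ
  exact ⟨p, c, hp, hc.symm⟩

end Rank

/-! ### Secant planes and their closure -/

section Secant

variable {K : Type*} [Field K]

/-- The maximal minors of the catalecticant with `k + 2` rows vanish on the secant `k`-planes. -/
theorem OnSecantPlane.det_submatrix_catalecticant {d k n : ℕ} (h : k + 1 + n = d)
    {Q : ℙ K (Functional K d)} (hQ : OnSecantPlane d k Q) (e : Fin (k + 2) → Fin (n + 1)) :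
    ((catalecticant h (coords d Q.rep)).submatrix id e).det = 0 := by
  obtain ⟨p, hp, -, hQp⟩ := hQ
  choose α hα hpα using hp
  obtain rfl : p = fun i => Projectivization.mk K (ev d (α i)) (ev_ne_zero d (hα i)) := funext hpα
  rw [← Q.mk_rep, mk_mem_span_range_iff, Submodule.mem_span_range_iff_exists_fun] at hQp
  obtain ⟨c, hc⟩ := hQp
  -- Vanishing at `k + 1` points imposes `k + 1` linear conditions on `k + 2` coefficients.
  let L : (Fin (k + 2) → K) →ₗ[K] (Fin (k + 1) → K) :=
    (of fun i => coords (k + 1) (ev (k + 1) (α i))).mulVecLin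
  obtain ⟨v, hv, hv0⟩ := (Submodule.ne_bot_iff _).mp
    (LinearMap.ker_ne_bot_of_finrank_lt (f := L) (by simp))
  refine exists_vecMul_eq_zero_iff.mp ⟨v, hv0, ?_⟩
  have hzero : v ᵥ* catalecticant h (coords d Q.rep) = 0 := by
    rw [← hc, vecMul_catalecticant_sum_ev]
    refine Finset.sum_eq_zero fun i _ => ?_
    have hi : v ⬝ᵥ coords (k + 1) (ev (k + 1) (α i)) = 0 := by
      rw [dotProduct_comm]
      exact congrFun (LinearMap.mem_ker.mp hv) i
    rw [hi, mul_zero, zero_smul]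
  ext j
  exact congrFun hzero (e j)

/-- A point of the secant variety is annihilated by a nonzero form of degree `k + 1`. -/
theorem exists_vecMul_catalecticant_eq_zero {d k n : ℕ} (h : k + 1 + n = d)
    {P : ℙ K (Functional K d)} (hP : P ∈ secantVariety K d k) :
    ∃ v ≠ 0, v ᵥ* catalecticant h (coords d P.rep) = 0 := by
  refine exists_vecMul_eq_zero_of_minors _ fun e => ?_
  -- The minor of the generic catalecticant is a form of degree `k + 2`, to which the definition of
  -- the closure applies.
  let M : Matrix (Fin (k + 2)) (Fin (k + 2)) (MvPolynomial (Fin (d + 1)) K) :=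
    (catalecticant h MvPolynomial.X).submatrix id e
  have heval : ∀ z : Fin (d + 1) → K, MvPolynomial.eval z M.det =
      ((catalecticant h z).submatrix id e).det := by
    intro z
    rw [RingHom.map_det]
    congr 1
    ext i j
    simp [M, catalecticant]
  rw [← heval]
  refine hP _ _ (isHomogeneous_det M fun i j => MvPolynomial.isHomogeneous_X _ _) fun Q hQ => ?_
  rw [heval]
  exact OnSecantPlane.det_submatrix_catalecticant h hQ e

/-- A combination of evaluations at `k + 1 ≤ d + 1` distinct points lies on a secant `k`-plane. -/
theorem onSecantPlane_of_mem_span [Infinite K] {d k : ℕ} (hk : k ≤ d) {φ : Functional K d}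
    (hφ : φ ≠ 0) {p : Fin (k + 1) → ℙ K (Fin 2 → K)} (hp : Function.Injective p)
    (hmem : φ ∈ Submodule.span K (Set.range fun i => ev d (p i).rep)) :
    OnSecantPlane d k (Projectivization.mk K φ hφ) := by
  have hne : ∀ i, ev d (p i).rep ≠ 0 := fun i => ev_ne_zero d (p i).rep_nonzero
  exact ⟨fun i => Projectivization.mk K (ev d (p i).rep) (hne i),
    fun i => ⟨(p i).rep, (p i).rep_nonzero, rfl⟩,
    Projectivization.Independent.mk _ hne (linearIndependent_ev (by omega) hp),
    (mk_mem_span_range_iff _ hne hφ).mpr hmem⟩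

/-- A functional of rank at most `n + 1` annihilated by a nonzero form of degree `k + 1`, where
`k + 1 + n = d`, lies on a secant `k`-plane. -/
theorem onSecantPlane_of_rank_le [IsAlgClosed K] {d k n : ℕ} (h : k + 1 + n = d)
    {φ : Functional K d} (hφ : φ ≠ 0) (hrank : rank d φ ≤ n + 1) {v : Fin (k + 2) → K}
    (hv0 : v ≠ 0) (hv : v ᵥ* catalecticant h (coords d φ) = 0) :
    OnSecantPlane d k (Projectivization.mk K φ hφ) := by
  classical
  obtain ⟨p, c, hp, hpc⟩ := exists_distinct_points_of_rank_le (by omega) φ hrank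
  have hroot : ∀ i, c i * v ⬝ᵥ coords (k + 1) (ev (k + 1) (p i).rep) = 0 := by
    rw [hpc, vecMul_catalecticant_sum_ev] at hv
    have hrows : LinearIndependent K fun i => coords n (ev n (p i).rep) :=
      linearIndependent_rows_iff_isUnit.mpr
        ((isUnit_iff_isUnit_det _).mpr (det_coords_ev_ne_zero hp).isUnit)
    exact Fintype.linearIndependent_iff.mp hrows _ hv
  let S : Finset (Fin (n + 1)) := Finset.univ.filter fun i => c i ≠ 0
  -- A nonzero form of degree `k + 1` cannot vanish at `k + 2` distinct points.
  have hS : S.card ≤ k + 1 := by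
    by_contra! hlt
    obtain ⟨U, hUS, hU⟩ := Finset.exists_subset_card_eq (Nat.succ_le_of_lt hlt)
    let e := (U.equivFinOfCardEq hU).symm
    refine det_coords_ev_ne_zero (p := fun i => p (e i))
      (hp.comp (Subtype.val_injective.comp e.injective))
      (exists_mulVec_eq_zero_iff.mp ⟨v, hv0, funext fun i => ?_⟩)
    have hi := (Finset.mem_filter.mp (hUS (e i).2)).2
    exact (dotProduct_comm _ _).trans ((mul_eq_zero.mp (hroot (e i))).resolve_left hi)
  -- Extra points bring the number to exactly `k + 1`, as a `k`-plane requires.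
  obtain ⟨q, hq, hSq⟩ := exists_injective_superset (S.image p) (Finset.card_image_le.trans hS)
  refine onSecantPlane_of_mem_span (by omega) hφ hq ?_
  rw [hpc]
  refine Submodule.sum_mem _ fun i _ => ?_
  by_cases hi : c i = 0
  · rw [hi, zero_smul]
    exact Submodule.zero_mem _
  · obtain ⟨j, hj⟩ := hSq (Finset.mem_coe.mpr
      (Finset.mem_image_of_mem p (show i ∈ S by simp [S, hi])))
    exact Submodule.smul_mem _ _ (Submodule.subset_span ⟨j, by simp only [hj]⟩)

end Secant

end BinaryForms

theorem mainTheorem2 {K : Type*} [Field K] [IsAlgClosed K] [CharZero K]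
    (d k : ℕ) (hd : 1 ≤ d) (hk : k ≤ (d - 1) / 2)
    (φ : BinaryForms.Functional K d) (hφ : φ ≠ 0)
    (hsec : Projectivization.mk K φ hφ ∈ BinaryForms.secantVariety K d k)
    (hplane : ¬ BinaryForms.OnSecantPlane d k (Projectivization.mk K φ hφ)) :
    d - k + 1 ≤ BinaryForms.rank d φ := by
  by_contra! hlt
  have h : k + 1 + (d - k - 1) = d := by omega
  obtain ⟨v, hv0, hv⟩ := BinaryForms.exists_vecMul_catalecticant_eq_zero h hsec
  refine hplane (BinaryForms.onSecantPlane_of_rank_le h hφ (by omega) hv0 ?_)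
  obtain ⟨a, ha⟩ := Projectivization.exists_smul_eq_mk_rep K φ hφ
  have hcat : BinaryForms.catalecticant h
      (BinaryForms.coords d (Projectivization.mk K φ hφ).rep) =
        (a : K) • BinaryForms.catalecticant h (BinaryForms.coords d φ) := by
    rw [← ha]
    rfl
  rw [hcat, Matrix.vecMul_smul] at hv
  exact (smul_eq_zero.mp hv).resolve_left a.ne_zero
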